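/- Setting. Let $R:\mathbb R\times\mathbb R^m\to\mathbb R^m$ and $G:\mathbb R^m\to\mathbb R$ be smooth ($C^\infty$), and let $G$ be an invariant of $q'(t)=R(t,q(t))$ on $[0,T]$, i.e. $\nabla G(q)^{T}R(t,q)=0$ for all $t\in[0,T]$, $q\in\mathbb R^m$. Let an explicit $s$-stage Runge–Kutta method with coefficients $a_{ij},b_j$, $c_i=\sum_j a_{ij}$, have order (at least) $p\ge 2$: for every smooth initial value problem in any dimension, its error after one step of size $h$ is $O(h^{p+1})$ as $h\downarrow0$. For a step of size $\Delta t>0$ from the value $q^n$ at time $t_n$ write $R_i=R\big(t_n+c_i\Delta t,\;q^n+\Delta t\sum_j a_{ij}R_j\big)$, $q^{n+1}=q^n+\Delta t\sum_j b_jR_j$ and $\mathcal S=\mathrm{span}(R_1,\dots,R_s)$; let $\nabla G_s$ be the orthogonal projection of $\nabla G(q^{n+1})$ onto $\mathcal S$. A projection method with search direction $\Phi$ replaces $q^{n+1}$ by $\hat q^{n+1}=q^{n+1}+\lambda_n\Phi$, where $\lambda_n\in\mathbb R$ is a solution of $G(\hat q^{n+1})=G(q^n)$. The directional method with embedded weights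 $\tilde b_j$ (arbitrary) uses the unit vector $\Phi_{n,d}=\sum_j(b_j-\tilde b_j)R_j\big/\big\|\sum_j(b_j-\tilde b_j)R_j\big\|_2$; the quasi-orthogonal method uses $\Phi=\nabla G_s/\|\nabla G_s\|_2$. Let $r$ be a real number with $0\le r\le p/2$. (a) One step. Fix $t_n\in[0,T)$ and $q^n\in\mathbb R^m$, and suppose that for some $B\ne0$ $$\nabla G(q^{n+1})^{T}\Phi_{n,d}=B\,\Delta t^{r}+O(\Delta t^{r+1})\qquad(\Delta t\downarrow0).$$ Then $\nabla G_s\neq0$ for all sufficiently small $\Delta t>0$, and both the directional and the quasi-orthogonal method are solvable with order at least $p-r$ there: for each of the two methods there is $\delta>0$ such that for all sufficiently small $\Delta t>0$ the projection equation has exactly one solution $\lambda_n$ with $|\lambda_n|\le\delta\,\Delta t^{r}$, and with this solution $\|\hat q^{n+1}-q(t_n+\Delta t)\|_2=O(\Delta t^{p-r+1})$, where $q$ is the exact solution with $q(t_n)=q^n$. (b) The whole interval. Let $u$ be an exact solution on $[0,T]$, and suppose that the expansion in (a) holds uniformly near $u$: there are $\rho,\beta,h_1>0$, $K\in\mathbb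 R$ and a function $B(t,q)$ such that, whenever $t_n\in[0,T]$ and $\|q^n-u(t_n)\|_2\le\rho$, one has $|B(t_n,q^n)|\ge\beta$, and $|\nabla G(q^{n+1})^{T}\Phi_{n,d}-B(t_n,q^n)\Delta t^{r}|\le K\Delta t^{r+1}$ for all $0<\Delta t\le h_1$ with $t_n+\Delta t\le T$. Then there are $\rho',h_0>0$ such that $\nabla G_s\ne0$ whenever $t_n\in[0,T]$, $\|q^n-u(t_n)\|_2\le\rho'$, $0<\Delta t\le h_0$ and $t_n+\Delta t\le T$. Moreover, for each of the two methods there are $\delta,h_0>0$ and $C$ such that for all $0<\Delta t\le h_0$ and all $N\in\mathbb N$ with $N\Delta t\le T$: starting from $\hat q^0=u(0)$, $N$ projected steps of size $\Delta t$ with $|\lambda_n|\le\delta\,\Delta t^{r}$ can be carried out, in any such computation each projection equation has exactly one solution in this window, and $\|\hat q^{n}-u(n\Delta t)\|_2\le C\,\Delta t^{p-r}$ for all $n\le N$. -/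

import Mathlib

open Set Filter Topology Asymptotics
open scoped ContDiff

/-- `u` solves the differential equation `u' = f (t, u)` on the interval `[t₀, t₁]`. -/
def IsSolutionOn {m : ℕ} (f : ℝ → EuclideanSpace ℝ (Fin m) → EuclideanSpace ℝ (Fin m))
    (t₀ t₁ : ℝ) (u : ℝ → EuclideanSpace ℝ (Fin m)) : Prop :=
  ∀ t ∈ Icc t₀ t₁, HasDerivWithinAt u (f t (u t)) (Icc t₀ t₁) t

/-- The coefficients of an explicit Runge-Kutta method with `s` stages. -/
structure ExplicitRK (s : ℕ) where
  a : Fin s → Fin s → ℝ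
  b : Fin s → ℝ
  explicit : ∀ i j, i ≤ j → a i j = 0

namespace ExplicitRK

/-- The abscissae `cᵢ = ∑ⱼ aᵢⱼ`. -/
noncomputable def c {s : ℕ} (M : ExplicitRK s) (i : Fin s) : ℝ := ∑ j, M.a i j

/-- The stage derivatives `Rᵢ`, computed one after the other; `stage_eq` below is their
usual defining equation. -/
noncomputable def stage {m s : ℕ} (M : ExplicitRK s)
    (f : ℝ → EuclideanSpace ℝ (Fin m) → EuclideanSpace ℝ (Fin m))
    (t : ℝ) (q : EuclideanSpace ℝ (Fin m)) (h : ℝ) (i : Fin s) : EuclideanSpace ℝ (Fin m) :=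
  f (t + M.c i * h)
    (q + h • ∑ j : Fin s, if _hj : j < i then M.a i j • stage M f t q h j else 0)
termination_by i.val

theorem stage_eq {m s : ℕ} (M : ExplicitRK s)
    (f : ℝ → EuclideanSpace ℝ (Fin m) → EuclideanSpace ℝ (Fin m))
    (t : ℝ) (q : EuclideanSpace ℝ (Fin m)) (h : ℝ) (i : Fin s) :
    M.stage f t q h i =
      f (t + M.c i * h) (q + h • ∑ j : Fin s, M.a i j • M.stage f t q h j) := by
  rw [stage]
  congr 3
  refine Finset.sum_congr rfl fun j _ => ?_
  by_cases hj : j < i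
  · simp [hj]
  · simp [hj, M.explicit i j (not_lt.mp hj)]

/-- One step of size `h` of the Runge-Kutta method, from the value `q` at time `t`. -/
noncomputable def step {m s : ℕ} (M : ExplicitRK s)
    (f : ℝ → EuclideanSpace ℝ (Fin m) → EuclideanSpace ℝ (Fin m))
    (t : ℝ) (q : EuclideanSpace ℝ (Fin m)) (h : ℝ) : EuclideanSpace ℝ (Fin m) :=
  q + h • ∑ j, M.b j • M.stage f t q h j

/-- The method has order (at least) `p`: for every smooth initial value problem, in any
dimension, the error after one step of size `h` is `O(h ^ (p + 1))`. -/
def HasOrder {s : ℕ} (M : ExplicitRK s) (p : ℕ) : Prop :=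
  ∀ (m : ℕ) (f : ℝ → EuclideanSpace ℝ (Fin m) → EuclideanSpace ℝ (Fin m)),
    ContDiff ℝ ∞ (fun x : ℝ × EuclideanSpace ℝ (Fin m) => f x.1 x.2) →
    ∀ (t₀ ε : ℝ) (u : ℝ → EuclideanSpace ℝ (Fin m)), 0 < ε → IsSolutionOn f t₀ (t₀ + ε) u →
      (fun h : ℝ => M.step f t₀ (u t₀) h - u (t₀ + h)) =O[𝓝[>] 0] fun h : ℝ => h ^ (p + 1)

/-- The span `𝒮` of the stage derivatives. -/
noncomputable def stageSpan {m s : ℕ} (M : ExplicitRK s)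
    (f : ℝ → EuclideanSpace ℝ (Fin m) → EuclideanSpace ℝ (Fin m))
    (t : ℝ) (q : EuclideanSpace ℝ (Fin m)) (h : ℝ) : Submodule ℝ (EuclideanSpace ℝ (Fin m)) :=
  Submodule.span ℝ (Set.range (M.stage f t q h))

/-- `∇G_s`: the orthogonal projection onto `𝒮` of the gradient of `G` at the new value. -/
noncomputable def gradS {m s : ℕ} (M : ExplicitRK s)
    (f : ℝ → EuclideanSpace ℝ (Fin m) → EuclideanSpace ℝ (Fin m))
    (G : EuclideanSpace ℝ (Fin m) → ℝ)
    (t : ℝ) (q : EuclideanSpace ℝ (Fin m)) (h : ℝ) : EuclideanSpace ℝ (Fin m) :=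
  (M.stageSpan f t q h).starProjection (gradient G (M.step f t q h))

/-- The search direction `∇G_s / ‖∇G_s‖` of the quasi-orthogonal projection method. -/
noncomputable def quasiOrthogonalDir {m s : ℕ} (M : ExplicitRK s)
    (f : ℝ → EuclideanSpace ℝ (Fin m) → EuclideanSpace ℝ (Fin m))
    (G : EuclideanSpace ℝ (Fin m) → ℝ)
    (t : ℝ) (q : EuclideanSpace ℝ (Fin m)) (h : ℝ) : EuclideanSpace ℝ (Fin m) :=
  ‖M.gradS f G t q h‖⁻¹ • M.gradS f G t q h

/-- The search direction `Φ_{n,d}` of the directional projection method whose embedded method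
has the weights `b'`: the normalization of `∑ⱼ (bⱼ - b'ⱼ) Rⱼ`. -/
noncomputable def directionalDir {m s : ℕ} (M : ExplicitRK s) (b' : Fin s → ℝ)
    (f : ℝ → EuclideanSpace ℝ (Fin m) → EuclideanSpace ℝ (Fin m))
    (t : ℝ) (q : EuclideanSpace ℝ (Fin m)) (h : ℝ) : EuclideanSpace ℝ (Fin m) :=
  ‖∑ j, (M.b j - b' j) • M.stage f t q h j‖⁻¹ • ∑ j, (M.b j - b' j) • M.stage f t q h j

/-- `l` is the projection parameter, with `|l| ≤ w`, for a step from `(t, q)` along the search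
direction `Φ`: the projected value `step + l Φ` lies on the level set of `G` through `q`. -/
def IsProjParam {m s : ℕ} (M : ExplicitRK s)
    (f : ℝ → EuclideanSpace ℝ (Fin m) → EuclideanSpace ℝ (Fin m))
    (G : EuclideanSpace ℝ (Fin m) → ℝ)
    (Φ : ℝ → EuclideanSpace ℝ (Fin m) → ℝ → EuclideanSpace ℝ (Fin m))
    (t : ℝ) (q : EuclideanSpace ℝ (Fin m)) (h w l : ℝ) : Prop :=
  |l| ≤ w ∧ G (M.step f t q h + l • Φ t q h) = G q

/-- One projected step from `(t, q)` along the direction `Φ` is solvable, with order `κ`.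
The projection equation has, for small `h > 0`, exactly one solution in a window
`|l| ≤ δ h ^ r` around `0` (a fixed neighbourhood of `0` when `r = 0`), and with this solution
the projected value differs from the exact solution through `(t, q)` by `O(h ^ (κ + 1))`. -/
def LocallySolvableWithOrder {m s : ℕ} (M : ExplicitRK s)
    (f : ℝ → EuclideanSpace ℝ (Fin m) → EuclideanSpace ℝ (Fin m))
    (G : EuclideanSpace ℝ (Fin m) → ℝ)
    (Φ : ℝ → EuclideanSpace ℝ (Fin m) → ℝ → EuclideanSpace ℝ (Fin m))
    (t : ℝ) (q : EuclideanSpace ℝ (Fin m)) (r κ : ℝ) : Prop :=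
  ∃ δ > 0,
    (∀ᶠ h in 𝓝[>] (0 : ℝ), ∃! l : ℝ, M.IsProjParam f G Φ t q h (δ * h ^ r) l) ∧
    ∀ (ε : ℝ) (u : ℝ → EuclideanSpace ℝ (Fin m)), 0 < ε → IsSolutionOn f t (t + ε) u → u t = q →
      ∃ C : ℝ, ∀ᶠ h in 𝓝[>] (0 : ℝ), ∀ l : ℝ, M.IsProjParam f G Φ t q h (δ * h ^ r) l →
        ‖M.step f t q h + l • Φ t q h - u (t + h)‖ ≤ C * h ^ (κ + 1)

/-- `y 0, …, y N` is produced by `N` projected steps of size `h` along `Φ`, starting at time `0`,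
with projection parameters in the window `[-w, w]`. -/
def IsProjectedRun {m s : ℕ} (M : ExplicitRK s)
    (f : ℝ → EuclideanSpace ℝ (Fin m) → EuclideanSpace ℝ (Fin m))
    (G : EuclideanSpace ℝ (Fin m) → ℝ)
    (Φ : ℝ → EuclideanSpace ℝ (Fin m) → ℝ → EuclideanSpace ℝ (Fin m))
    (q₀ : EuclideanSpace ℝ (Fin m)) (h w : ℝ) (N : ℕ) (y : ℕ → EuclideanSpace ℝ (Fin m)) : Prop :=
  y 0 = q₀ ∧ ∀ n < N, ∃ l : ℝ, M.IsProjParam f G Φ (n * h) (y n) h w l ∧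
    y (n + 1) = M.step f (n * h) (y n) h + l • Φ (n * h) (y n) h

/-- The projection method along `Φ` is solvable on `[0, T]` and converges with order `κ` to the
exact solution `u`: for step sizes `h ≤ h₀`, every step from a value `y n` reached has exactly one
projection parameter in the window `|l| ≤ δ h ^ r`, the method can be run as long as the
time stays in `[0, T]`, and the error is at most `C h ^ κ` throughout. -/
def GloballySolvableWithOrder {m s : ℕ} (M : ExplicitRK s)
    (f : ℝ → EuclideanSpace ℝ (Fin m) → EuclideanSpace ℝ (Fin m))
    (G : EuclideanSpace ℝ (Fin m) → ℝ)
    (Φ : ℝ → EuclideanSpace ℝ (Fin m) → ℝ → EuclideanSpace ℝ (Fin m))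
    (T : ℝ) (u : ℝ → EuclideanSpace ℝ (Fin m)) (r κ : ℝ) : Prop :=
  ∃ δ > 0, ∃ h₀ > 0, ∃ C : ℝ, ∀ h ∈ Ioc 0 h₀, ∀ N : ℕ, N * h ≤ T →
    (∃ y, M.IsProjectedRun f G Φ (u 0) h (δ * h ^ r) N y) ∧
    ∀ y, M.IsProjectedRun f G Φ (u 0) h (δ * h ^ r) N y →
      (∀ n < N, ∃! l : ℝ, M.IsProjParam f G Φ (n * h) (y n) h (δ * h ^ r) l) ∧
      ∀ n ≤ N, ‖y n - u (n * h)‖ ≤ C * h ^ κ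

end ExplicitRK

/-! ### Taylor remainders with constants uniform over a compact set. -/

section Taylor

variable {V F : Type*} [NormedAddCommGroup V] [NormedSpace ℝ V]
  [NormedAddCommGroup F] [NormedSpace ℝ F]

/-! Along a direction `Φ` the projection equation is a scalar equation for `λ`, with slope `A =
∇G(q^{n+1})ᵀΦ`, where `|A| ≥ c h^r`, and constant term the defect `G(q^{n+1}) - G(q^n)`. As `G` is
constant along exact solutions, the defect is `O(h^(p+1))`. On a window of half-width `w = δ h^r`
with `δ` small the slope stays within `|A|/2` of `A`, so there is exactly one root once the defect
is at most `|A| w / 2`, which is of order at least `h^(2r)`; this is where `r ≤ p/2` enters. The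
root is `O(h^(p+1) / h^r)`, hence the loss of `r` orders (`exists_projection_window`).

The quasi-orthogonal direction inherits the lower bound on the slope: `Φ_{n,d}` lies in `𝒮`, so its
slope is at most `‖∇G_s‖`, which is the slope along `∇G_s / ‖∇G_s‖`.

Convergence is a discrete Gronwall argument in a tube around `u`, and needs constants uniform in the
starting value, whereas `HasOrder` gives one constant per initial value problem.
`exists_uniform_pow_bound` bridges this gap: a pointwise `O(h^(p+1))` forces the derivatives of
order at most `p` at `0` to vanish, and the Taylor remainder is controlled by a single continuous
function on a compact set. -/

theorem norm_sub_pow_smul_le_of_chain {ε η : ℝ} {c : F} (n : ℕ) (w : ℕ → ℝ → F)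
    (hw : ∀ k, ∀ x ∈ Icc 0 ε, HasDerivWithinAt (w k) (w (k + 1) x) (Icc 0 ε) x)
    (h0 : ∀ k < n, w k 0 = 0) (hn : ∀ x ∈ Icc 0 ε, ‖w n x - c‖ ≤ η) :
    ∀ x ∈ Icc 0 ε, ‖w 0 x - (x ^ n / n.factorial) • c‖ ≤ η * x ^ n := by
  induction n generalizing w with
  | zero => simpa using hn
  | succ n ih =>
    -- The induction hypothesis for the shifted chain bounds the derivative by `η * y ^ n`; the mean
    -- value inequality on `[0, x]` then adds one factor `x`.
    have h1 := ih (fun k => w (k + 1)) (fun k => hw (k + 1))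
      (fun k hk => h0 (k + 1) (by omega)) hn
    intro x hx
    have hη : 0 ≤ η := (norm_nonneg _).trans (hn x hx)
    have hd : ∀ y ∈ Icc 0 x, HasDerivWithinAt
        (fun y => w 0 y - (y ^ (n + 1) / (n + 1).factorial) • c)
        (w 1 y - (y ^ n / n.factorial) • c) (Icc 0 x) y := by
      intro y hy
      refine ((hw 0 y ⟨hy.1, hy.2.trans hx.2⟩).mono (Icc_subset_Icc_right hx.2)).sub ?_
      have : HasDerivAt (fun y : ℝ => y ^ (n + 1) / ((n + 1).factorial : ℝ))
          (y ^ n / n.factorial) y := by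
        refine ((hasDerivAt_pow (n + 1) y).div_const ((n + 1).factorial : ℝ)).congr_deriv ?_
        rw [Nat.factorial_succ]
        push_cast
        have : (n.factorial : ℝ) ≠ 0 := by positivity
        field_simp
      exact (this.smul_const c).hasDerivWithinAt
    have hb := norm_image_sub_le_of_norm_deriv_le_segment' (C := η * x ^ n) hd
      (fun y hy => (h1 y ⟨hy.1, hy.2.le.trans hx.2⟩).trans
        (mul_le_mul_of_nonneg_left (pow_le_pow_left₀ hy.1 hy.2.le n) hη)) x ⟨hx.1, le_rfl⟩
    simpa [h0 0 (Nat.succ_pos n), pow_succ, mul_assoc] using hb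

/-- At the first nonzero derivative `c`, of order `k ≤ p`, the function behaves like `(h ^ k / k!) •
c`, which is not `O(h ^ (p + 1))`. -/
theorem chain_zero_eq_zero_of_isBigO {ε : ℝ} (hε : 0 < ε) (p : ℕ) (w : ℕ → ℝ → F)
    (hw : ∀ k, ∀ x ∈ Icc 0 ε, HasDerivWithinAt (w k) (w (k + 1) x) (Icc 0 ε) x)
    (hO : w 0 =O[𝓝[>] 0] fun h : ℝ => h ^ (p + 1)) :
    ∀ k < p + 1, w k 0 = 0 := by
  intro k
  induction k using Nat.strong_induction_on with
  | _ k ih =>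
    intro hk
    by_contra hne
    set c := w k 0 with hc
    set a : ℝ := ‖c‖ / k.factorial with ha
    have ha0 : 0 < a := by positivity
    -- Tolerance `a / 2` leaves at least `a / 2 * h ^ k` of the leading term `a * h ^ k`, against
    -- the upper bound `C * h * h ^ k`.
    have hcont : ∀ᶠ x in 𝓝[Icc 0 ε] 0, ‖w k x - c‖ < a / 2 := by
      have := (hw k 0 ⟨le_rfl, hε.le⟩).continuousWithinAt
      simpa [dist_eq_norm] using Metric.tendsto_nhds.1 this (a / 2) (by positivity)
    rw [nhdsWithin_Icc_eq_nhdsGE hε] at hcont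
    obtain ⟨e, he, hE⟩ := mem_nhdsGE_iff_exists_Icc_subset.1 hcont
    have hT := norm_sub_pow_smul_le_of_chain (ε := min e ε) (η := a / 2) (c := c) k w
      (fun j x hx => (hw j x ⟨hx.1, hx.2.trans (min_le_right _ _)⟩).mono
        (Icc_subset_Icc_right (min_le_right _ _)))
      (fun j hj => ih j hj (by omega))
      (fun x hx => (hE ⟨hx.1, hx.2.trans (min_le_left _ _)⟩).le)
    obtain ⟨C, hC0, hC⟩ := hO.exists_pos
    have hlim : ∀ᶠ h : ℝ in 𝓝[>] 0, C * h < a / 2 := by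
      have : Tendsto (fun h : ℝ => C * h) (𝓝[>] 0) (𝓝 (C * 0)) :=
        ((continuous_const_mul C).tendsto 0).mono_left nhdsWithin_le_nhds
      rw [mul_zero] at this
      exact this.eventually_lt_const (by positivity)
    have hsm : ∀ᶠ h : ℝ in 𝓝[>] 0, h < min 1 (min e ε) :=
      (eventually_lt_nhds (by positivity)).filter_mono nhdsWithin_le_nhds
    obtain ⟨h, hb, hl, hs, hpos⟩ :=
      (hC.bound.and (hlim.and (hsm.and self_mem_nhdsWithin))).exists
    have h1 := hT h ⟨hpos.le, (hs.trans_le (min_le_right _ _)).le⟩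
    have h2 : ‖(h ^ k / (k.factorial : ℝ)) • c‖ = a * h ^ k := by
      rw [norm_smul, Real.norm_of_nonneg (by positivity), ha]
      ring
    have h3 : a * h ^ k ≤ a / 2 * h ^ k + ‖w 0 h‖ := by
      rw [← h2]
      have := norm_sub_norm_le ((h ^ k / (k.factorial : ℝ)) • c) (w 0 h)
      rw [norm_sub_rev] at this
      linarith
    have h4 : ‖w 0 h‖ ≤ C * h * h ^ k := by
      refine hb.trans ?_
      rw [Real.norm_of_nonneg (by positivity), mul_assoc, ← pow_succ']
      exact mul_le_mul_of_nonneg_left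
        (pow_le_pow_of_le_one hpos.le (hs.trans_le (min_le_left _ _)).le (by omega)) hC0.le
    nlinarith [pow_pos hpos k]

/-- The iterated derivatives of `φ` along the vector field `X`. -/
noncomputable def iterLieDeriv (X : V → V) (φ : V → F) : ℕ → V → F
  | 0 => φ
  | k + 1 => fun x => fderiv ℝ (iterLieDeriv X φ k) x (X x)

theorem contDiff_iterLieDeriv {X : V → V} {φ : V → F} (hX : ContDiff ℝ ∞ X)
    (hφ : ContDiff ℝ ∞ φ) (k : ℕ) : ContDiff ℝ ∞ (iterLieDeriv X φ k) := by
  induction k with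
  | zero => exact hφ
  | succ k ih => exact (ih.fderiv_right (m := ∞) (by simp)).clm_apply hX

/-- A smooth function which is `O(h ^ (p + 1))` along each of the integral curves considered is so
with a common constant, as long as these curves stay in a fixed compact set. -/
theorem exists_uniform_pow_bound {X : V → V} {φ : V → F} (hX : ContDiff ℝ ∞ X)
    (hφ : ContDiff ℝ ∞ φ) (p : ℕ) {K : Set V} (hK : IsCompact K) :
    ∃ C : ℝ, 0 ≤ C ∧ ∀ (ε : ℝ) (γ : ℝ → V), 0 < ε →
      (∀ h ∈ Icc 0 ε, HasDerivWithinAt γ (X (γ h)) (Icc 0 ε) h) → (∀ h ∈ Icc 0 ε, γ h ∈ K) →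
      ((fun h => φ (γ h)) =O[𝓝[>] 0] fun h : ℝ => h ^ (p + 1)) →
      ∀ h ∈ Icc 0 ε, ‖φ (γ h)‖ ≤ C * h ^ (p + 1) := by
  -- The `k`-th derivative of `φ ∘ γ` is the `k`-th Lie derivative evaluated on `γ`, so this
  -- supremum serves every curve in `K`.
  obtain ⟨C, hC⟩ := hK.exists_bound_of_continuousOn
    (contDiff_iterLieDeriv hX hφ (p + 1)).continuous.continuousOn
  refine ⟨max C 0, le_max_right _ _, fun ε γ hε hγ hmem hO h hh => ?_⟩
  have hw : ∀ k, ∀ x ∈ Icc 0 ε, HasDerivWithinAt (fun h => iterLieDeriv X φ k (γ h))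
      (iterLieDeriv X φ (k + 1) (γ x)) (Icc 0 ε) x := fun k x hx =>
    ((contDiff_iterLieDeriv hX hφ k).differentiable (by simp) (γ x)).hasFDerivAt.comp_hasDerivWithinAt
      x (hγ x hx)
  have h0 := chain_zero_eq_zero_of_isBigO hε p (fun k h => iterLieDeriv X φ k (γ h)) hw hO
  simpa [iterLieDeriv] using norm_sub_pow_smul_le_of_chain (η := max C 0) (c := 0) (p + 1)
    (fun k h => iterLieDeriv X φ k (γ h)) hw h0
    (fun x hx => by simpa using Or.inl (hC _ (hmem x hx))) h hh

end Taylor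

/-! ### The scalar projection equation. -/

section Projection

/-- If `F` is close to an affine function of slope `A` on `[-w, w]`, and small at `0`, then it has
exactly one zero there, of size at most `2 |F 0| / |A|`. -/
theorem existsUnique_zero_of_approx_affine {F : ℝ → ℝ} {A w : ℝ} (hw : 0 < w) (hA : A ≠ 0)
    (hF : ∀ x ∈ Icc (-w) w, ∀ y ∈ Icc (-w) w, |F x - F y - A * (x - y)| ≤ |A| / 2 * |x - y|)
    (h0 : |F 0| ≤ |A| / 2 * w) :
    (∃! l, |l| ≤ w ∧ F l = 0) ∧ ∀ l, |l| ≤ w → F l = 0 → |A| / 2 * |l| ≤ |F 0| := by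
  wlog hpos : 0 < A generalizing F A
  · have := this (F := fun x => -F x) (A := -A) (neg_ne_zero.2 hA)
      (fun x hx y hy => by
        have := hF x hx y hy
        rw [← abs_neg] at this
        rw [abs_neg A]
        convert this using 2
        ring)
      (by simpa using h0) (by
        rcases lt_or_gt_of_ne hA with h | h
        · linarith
        · exact absurd h hpos)
    simpa using this
  have hm : (0 : ℝ) ∈ Icc (-w) w := ⟨by linarith, hw.le⟩
  have hA' : |A| = A := abs_of_pos hpos
  rw [hA'] at hF h0 ⊢
  -- `F` separates points at rate at least `A / 2`: this yields both uniqueness and the size of the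
  -- root.
  have key : ∀ x ∈ Icc (-w) w, ∀ y ∈ Icc (-w) w, A / 2 * |x - y| ≤ |F x - F y| := by
    intro x hx y hy
    have h1 := hF x hx y hy
    have h2 := abs_sub_abs_le_abs_sub (A * (x - y)) (F x - F y)
    rw [abs_mul, hA', abs_sub_comm (A * (x - y))] at h2
    linarith
  have hcont : ContinuousOn F (Icc (-w) w) := by
    refine (LipschitzOnWith.of_dist_le_mul (K := ⟨3 * A / 2, by positivity⟩)
      fun x hx y hy => ?_).continuousOn
    rw [Real.dist_eq, Real.dist_eq]
    have h1 := hF x hx y hy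
    have h2 := abs_sub_abs_le_abs_sub (F x - F y) (A * (x - y))
    rw [abs_mul, hA'] at h2
    change _ ≤ 3 * A / 2 * _
    linarith
  refine ⟨?_, fun l hl hz => ?_⟩
  -- From `0` to `±w` the function moves by at least `A / 2 * w` in the direction of the sign, so `F
  -- (-w) ≤ 0 ≤ F w`.
  · have hr := hF w ⟨by linarith, le_rfl⟩ 0 hm
    have hl := hF (-w) ⟨le_rfl, by linarith⟩ 0 hm
    rw [sub_zero, abs_of_pos hw] at hr
    rw [sub_zero, abs_neg, abs_of_pos hw] at hl
    rw [abs_le] at hr hl h0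
    obtain ⟨l, hl1, hl2⟩ := intermediate_value_Icc (by linarith : -w ≤ w) hcont
      (show (0 : ℝ) ∈ Icc (F (-w)) (F w) from ⟨by linarith, by linarith⟩)
    refine ⟨l, ⟨abs_le.2 hl1, hl2⟩, fun l' hl' => ?_⟩
    have := key l' (abs_le.1 hl'.1) l hl1
    rw [hl'.2, hl2, sub_zero, abs_zero] at this
    have h3 : |l' - l| ≤ 0 := by
      by_contra h
      have := mul_pos (half_pos hpos) (not_le.1 h)
      linarith
    exact sub_eq_zero.1 (abs_nonpos_iff.1 h3)
  · have := key l (abs_le.1 hl) 0 hm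
    rwa [hz, zero_sub, abs_neg, sub_zero] at this

variable {E : Type*} [NormedAddCommGroup E] [InnerProductSpace ℝ E] [FiniteDimensional ℝ E]

/-- Mean value inequality with a Lipschitz constant of the derivative on the ball of radius `ρ + 1`,
which contains every `x + a • Φ` with `|a| ≤ w ≤ 1`. -/
theorem exists_gradient_approx {G : E → ℝ} (hG : ContDiff ℝ ∞ G) (ρ : ℝ) :
    ∃ L : ℝ, 0 ≤ L ∧ ∀ x Φ : E, ‖x‖ ≤ ρ → ‖Φ‖ ≤ 1 → ∀ w : ℝ, w ≤ 1 →
      ∀ a ∈ Icc (-w) w, ∀ b ∈ Icc (-w) w,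
        |G (x + a • Φ) - G (x + b • Φ) - inner ℝ (gradient G x) Φ * (a - b)| ≤ L * w * |a - b| := by
  obtain ⟨L, hL⟩ := ContDiffOn.exists_lipschitzOnWith (s := Metric.closedBall (0 : E) (ρ + 1))
    (hG.fderiv_right (m := ∞) (by simp)).contDiffOn (by simp) (convex_closedBall _ _)
    (isCompact_closedBall _ _)
  refine ⟨L, L.2, fun x Φ hx hΦ w hw a ha b hb => ?_⟩
  have hw0 : 0 ≤ w := by linarith [ha.1, ha.2]
  have hmem : ∀ c ∈ Icc (-w) w, x + c • Φ ∈ Metric.closedBall x w := fun c hc => by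
    rw [mem_closedBall_iff_norm, add_sub_cancel_left, norm_smul]
    calc ‖c‖ * ‖Φ‖ ≤ w * 1 := mul_le_mul (abs_le.2 hc) hΦ (norm_nonneg _) hw0
      _ = w := mul_one w
  have hsub : Metric.closedBall x w ⊆ Metric.closedBall 0 (ρ + 1) :=
    Metric.closedBall_subset_closedBall' (by rw [dist_zero_right]; linarith)
  have := (convex_closedBall x w).norm_image_sub_le_of_norm_fderiv_le' (𝕜 := ℝ) (f := G)
    (φ := fderiv ℝ G x) (C := L * w)
    (fun y _ => hG.differentiable (by simp) y)
    (fun y hy => ?_) (hmem b hb) (hmem a ha)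
  · have h1 : x + a • Φ - (x + b • Φ) = (a - b) • Φ := by rw [sub_smul]; abel
    have h2 : inner ℝ (gradient G x) Φ = fderiv ℝ G x Φ := by
      rw [gradient, InnerProductSpace.toDual_symm_apply]
    rw [h1, map_smul, smul_eq_mul, mul_comm, ← h2, norm_smul] at this
    refine (Real.norm_eq_abs _ ▸ this).trans ?_
    refine mul_le_mul_of_nonneg_left ?_ (mul_nonneg L.2 hw0)
    exact mul_le_of_le_one_right (norm_nonneg _) hΦ
  · rw [← dist_eq_norm]
    refine (hL.dist_le_mul y (hsub hy) x (hsub (Metric.mem_closedBall_self hw0))).trans ?_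
    exact mul_le_mul_of_nonneg_left hy L.2

/-- Solvability of the projection equation near a point `x` with `G x ≈ g`, along a direction `Φ`
which is transversal to the level sets of `G` at the rate `h ^ r`. -/
theorem exists_projection_window {G : E → ℝ} (hG : ContDiff ℝ ∞ G) (ρ : ℝ) {C c r : ℝ} {p : ℕ}
    (hC : 0 ≤ C) (hc : 0 < c) (hr0 : 0 ≤ r) (hr : r ≤ p / 2) :
    ∃ δ > 0, ∃ h₀ > 0, h₀ ≤ 1 ∧ ∃ C' : ℝ, 0 ≤ C' ∧ ∀ h ∈ Ioc 0 h₀, ∀ (x Φ : E) (g : ℝ),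
      ‖x‖ ≤ ρ → ‖Φ‖ ≤ 1 → |G x - g| ≤ C * h ^ (p + 1) →
      c * h ^ r ≤ |inner ℝ (gradient G x) Φ| →
      (∃! l : ℝ, |l| ≤ δ * h ^ r ∧ G (x + l • Φ) = g) ∧
      ∀ l : ℝ, |l| ≤ δ * h ^ r → G (x + l • Φ) = g → |l| ≤ C' * h ^ (p - r + 1) := by
  obtain ⟨L, hL0, hL⟩ := exists_gradient_approx hG ρ
  -- `δ` makes the variation of the slope, `L δ h^r`, at most half of the lower bound `c h^r`; `h₀`
  -- makes `C h ≤ c δ / 2`, which controls the defect.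
  set δ := min 1 (c / (2 * (L + 1))) with hδ
  have hδ0 : 0 < δ := by positivity
  set h₀ := min 1 (c * δ / (2 * (C + 1))) with hh₀
  refine ⟨δ, hδ0, h₀, by positivity, min_le_left _ _, 2 * C / c, by positivity, ?_⟩
  intro h hh x Φ g hx hΦ hg hA
  have hpos : 0 < h := hh.1
  have h1 : h ≤ 1 := hh.2.trans (min_le_left _ _)
  have hhr : 0 < h ^ r := Real.rpow_pos_of_pos hpos r
  set A := inner ℝ (gradient G x) Φ with hAdef
  have hA0 : 0 < |A| := (mul_pos hc hhr).trans_le hA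
  have hw1 : δ * h ^ r ≤ 1 :=
    mul_le_one₀ (min_le_left _ _) hhr.le (Real.rpow_le_one hpos.le h1 hr0)
  have hLw : L * (δ * h ^ r) ≤ |A| / 2 := by
    have : L * δ ≤ c / 2 := by
      have h2 : δ * (2 * (L + 1)) ≤ c := (le_div_iff₀ (by positivity)).1 (min_le_right _ _)
      nlinarith
    nlinarith
  have hCw : C * h ^ (p + 1) ≤ |A| / 2 * (δ * h ^ r) := by
    -- The only use of `r ≤ p / 2` in this argument.
    have h2 : h ^ p ≤ h ^ r * h ^ r := by
      rw [← Real.rpow_add hpos, ← Real.rpow_natCast]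
      exact Real.rpow_le_rpow_of_exponent_ge hpos h1 (by linarith)
    have h3 : C * h ≤ c * δ / 2 := by
      have h4 : h * (2 * (C + 1)) ≤ c * δ :=
        (le_div_iff₀ (by positivity)).1 (hh.2.trans (min_le_right _ _))
      nlinarith
    calc C * h ^ (p + 1) = C * h * h ^ p := by ring
      _ ≤ c * δ / 2 * (h ^ r * h ^ r) := mul_le_mul h3 h2 (by positivity) (by positivity)
      _ = c * h ^ r * (δ * h ^ r / 2) := by ring
      _ ≤ |A| * (δ * h ^ r / 2) := mul_le_mul_of_nonneg_right hA (by positivity)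
      _ = |A| / 2 * (δ * h ^ r) := by ring
  have hmain := existsUnique_zero_of_approx_affine (F := fun l => G (x + l • Φ) - g) (A := A)
    (w := δ * h ^ r) (by positivity) (abs_pos.1 hA0)
    (fun a ha b hb => by
      have := (hL x Φ hx hΦ _ hw1 a ha b hb).trans
        (mul_le_mul_of_nonneg_right hLw (abs_nonneg _))
      simpa only [sub_sub_sub_cancel_right] using this)
    (by simpa using hg.trans hCw)
  simp only [sub_eq_zero, zero_smul, add_zero] at hmain
  refine ⟨hmain.1, fun l hl hz => ?_⟩
  have h2 := (hmain.2 l hl hz).trans hg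
  have h3 : h ^ (p - r + 1) * h ^ r = h ^ (p + 1) := by
    rw [← Real.rpow_add hpos, ← Real.rpow_natCast]
    congr 1
    push_cast
    ring
  have h4 : c * h ^ r * |l| ≤ 2 * C * h ^ (p + 1) := by
    have := mul_le_mul_of_nonneg_right hA (abs_nonneg l)
    linarith
  rw [← h3] at h4
  rw [div_mul_eq_mul_div, le_div_iff₀ hc]
  refine le_of_mul_le_mul_right ?_ hhr
  linarith

end Projection

/-! ### Exact solutions and invariants. -/

section Solutions

variable {m : ℕ} {f : ℝ → EuclideanSpace ℝ (Fin m) → EuclideanSpace ℝ (Fin m)}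

theorem IsSolutionOn.mono {t₀ t₁ s₀ s₁ : ℝ} {u : ℝ → EuclideanSpace ℝ (Fin m)}
    (hu : IsSolutionOn f t₀ t₁ u) (h₀ : t₀ ≤ s₀) (h₁ : s₁ ≤ t₁) : IsSolutionOn f s₀ s₁ u :=
  fun t ht => (hu t ⟨h₀.trans ht.1, ht.2.trans h₁⟩).mono (Icc_subset_Icc h₀ h₁)

theorem IsSolutionOn.continuousOn {t₀ t₁ : ℝ} {u : ℝ → EuclideanSpace ℝ (Fin m)}
    (hu : IsSolutionOn f t₀ t₁ u) : ContinuousOn u (Icc t₀ t₁) :=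
  fun t ht => (hu t ht).continuousWithinAt

theorem IsSolutionOn.hasDerivWithinAt_shift {t ε : ℝ} {u : ℝ → EuclideanSpace ℝ (Fin m)}
    (hu : IsSolutionOn f t (t + ε) u) :
    ∀ h ∈ Icc 0 ε, HasDerivWithinAt (fun h => u (t + h)) (f (t + h) (u (t + h))) (Icc 0 ε) h := by
  intro h hh
  have h1 : HasDerivWithinAt (fun h : ℝ => t + h) 1 (Icc 0 ε) h :=
    ((hasDerivAt_id h).const_add t).hasDerivWithinAt
  simpa using! (hu (t + h) ⟨by linarith [hh.1], by linarith [hh.2]⟩).scomp h h1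
    (fun x hx => ⟨by linarith [hx.1], by linarith [hx.2]⟩)

theorem IsSolutionOn.tendsto_shift {t ε : ℝ} (hε : 0 < ε) {u : ℝ → EuclideanSpace ℝ (Fin m)}
    (hu : IsSolutionOn f t (t + ε) u) :
    Tendsto (fun h => u (t + h)) (𝓝[>] 0) (𝓝 (u t)) := by
  have h1 := (hu.hasDerivWithinAt_shift 0 ⟨le_rfl, hε.le⟩).continuousWithinAt.tendsto
  rw [nhdsWithin_Icc_eq_nhdsGE hε, add_zero] at h1
  exact h1.mono_left (nhdsWithin_mono _ Ioi_subset_Ici_self)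

/-- Local existence of solutions (Picard-Lindelöf). -/
theorem exists_isSolutionOn
    (hf : ContDiff ℝ ∞ (fun x : ℝ × EuclideanSpace ℝ (Fin m) => f x.1 x.2))
    (t : ℝ) (q : EuclideanSpace ℝ (Fin m)) :
    ∃ ε > 0, ∃ u : ℝ → EuclideanSpace ℝ (Fin m), IsSolutionOn f t (t + ε) u ∧ u t = q := by
  -- Time is adjoined as a state with derivative `1`, making the system autonomous; `h1` below
  -- recovers that this component is the time.
  have hX : ContDiff ℝ 1 (fun x : ℝ × EuclideanSpace ℝ (Fin m) => ((1 : ℝ), f x.1 x.2)) :=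
    (contDiff_const.prodMk hf).of_le (by norm_cast)
  obtain ⟨α, hα, ε, hε, hd⟩ := hX.contDiffAt
    |>.exists_forall_mem_closedBall_exists_eq_forall_mem_Ioo_hasDerivAt₀ (x₀ := (t, q)) t
  have h1 : ∀ s ∈ Icc t (t + ε / 2), (α s).1 = s := by
    have hsub : Icc t (t + ε / 2) ⊆ Ioo (t - ε) (t + ε) := fun s hs =>
      ⟨by linarith [hs.1], by linarith [hs.2]⟩
    have hg : ∀ s ∈ Ioo (t - ε) (t + ε), HasDerivAt (fun s => (α s).1 - s) 0 s := fun s hs => by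
      simpa using! (hasFDerivAt_fst.comp_hasDerivAt s (hd s hs)).sub (hasDerivAt_id s)
    intro s hs
    have := constant_of_has_deriv_right_zero
      (fun s hs => (hg s (hsub hs)).continuousAt.continuousWithinAt)
      (fun s hs => (hg s (hsub (Ico_subset_Icc_self hs))).hasDerivWithinAt) s hs
    simp only [hα, sub_self] at this
    linarith
  refine ⟨ε / 2, by positivity, fun s => (α s).2, fun s hs => ?_, by simp [hα]⟩
  have h2 := hasFDerivAt_snd.comp_hasDerivAt s
    (hd s ⟨by linarith [hs.1], by linarith [hs.2]⟩)
  rw [h1 s hs] at h2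
  exact h2.hasDerivWithinAt

/-- An invariant is constant along solutions. -/
theorem IsSolutionOn.invariant_eq {t₀ t₁ : ℝ} {u : ℝ → EuclideanSpace ℝ (Fin m)}
    (hu : IsSolutionOn f t₀ t₁ u) {G : EuclideanSpace ℝ (Fin m) → ℝ} (hG : ContDiff ℝ ∞ G)
    (hinv : ∀ t ∈ Icc t₀ t₁, ∀ q, inner ℝ (gradient G q) (f t q) = 0) :
    ∀ t ∈ Icc t₀ t₁, G (u t) = G (u t₀) := by
  intro t ht
  have hd : ∀ s ∈ Icc t₀ t₁, HasDerivWithinAt (fun s => G (u s)) 0 (Icc t₀ t₁) s := by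
    intro s hs
    have := (hG.differentiable (by simp) (u s)).hasFDerivAt.comp_hasDerivWithinAt s (hu s hs)
    have h0 : fderiv ℝ G (u s) (f s (u s)) = 0 := by
      rw [← hinv s hs (u s), gradient, InnerProductSpace.toDual_symm_apply]
    rwa [h0] at this
  have := norm_image_sub_le_of_norm_deriv_le_segment' (C := 0) hd (by simp) t ht
  rw [zero_mul, norm_le_zero_iff, sub_eq_zero] at this
  exact this

end Solutions

/-! ### Smoothness of the step map, and uniform one-step estimates. -/

namespace ExplicitRK

variable {m s : ℕ} {f : ℝ → EuclideanSpace ℝ (Fin m) → EuclideanSpace ℝ (Fin m)}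

theorem contDiff_stage (M : ExplicitRK s)
    (hf : ContDiff ℝ ∞ (fun x : ℝ × EuclideanSpace ℝ (Fin m) => f x.1 x.2)) (i : Fin s) :
    ContDiff ℝ ∞ (fun z : ℝ × EuclideanSpace ℝ (Fin m) × ℝ => M.stage f z.1 z.2.1 z.2.2 i) := by
  induction i using WellFoundedLT.induction with
  | ind i ih =>
    have hsum : ContDiff ℝ ∞ (fun z : ℝ × EuclideanSpace ℝ (Fin m) × ℝ =>
        ∑ j, M.a i j • M.stage f z.1 z.2.1 z.2.2 j) := by
      refine ContDiff.sum fun j _ => ?_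
      by_cases hj : j < i
      · exact (ih j hj).const_smul (M.a i j)
      · simpa [M.explicit i j (not_lt.1 hj)] using contDiff_const
    have : (fun z : ℝ × EuclideanSpace ℝ (Fin m) × ℝ => M.stage f z.1 z.2.1 z.2.2 i) =
        (fun x : ℝ × EuclideanSpace ℝ (Fin m) => f x.1 x.2) ∘
          fun z : ℝ × EuclideanSpace ℝ (Fin m) × ℝ => (z.1 + M.c i * z.2.2,
            z.2.1 + z.2.2 • ∑ j, M.a i j • M.stage f z.1 z.2.1 z.2.2 j) := by
      funext z
      exact M.stage_eq f z.1 z.2.1 z.2.2 i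
    rw [this]
    exact hf.comp (by fun_prop)

theorem contDiff_increment (M : ExplicitRK s)
    (hf : ContDiff ℝ ∞ (fun x : ℝ × EuclideanSpace ℝ (Fin m) => f x.1 x.2)) :
    ContDiff ℝ ∞ (fun z : ℝ × EuclideanSpace ℝ (Fin m) × ℝ =>
      ∑ j, M.b j • M.stage f z.1 z.2.1 z.2.2 j) :=
  ContDiff.sum fun j _ => (M.contDiff_stage hf j).const_smul (M.b j)

theorem contDiff_step (M : ExplicitRK s)
    (hf : ContDiff ℝ ∞ (fun x : ℝ × EuclideanSpace ℝ (Fin m) => f x.1 x.2)) :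
    ContDiff ℝ ∞ (fun z : ℝ × EuclideanSpace ℝ (Fin m) × ℝ => M.step f z.1 z.2.1 z.2.2) := by
  have := M.contDiff_increment hf
  unfold step
  fun_prop

theorem tendsto_step (M : ExplicitRK s)
    (hf : ContDiff ℝ ∞ (fun x : ℝ × EuclideanSpace ℝ (Fin m) => f x.1 x.2))
    (t : ℝ) (q : EuclideanSpace ℝ (Fin m)) :
    Tendsto (fun h => M.step f t q h) (𝓝[>] 0) (𝓝 q) := by
  have h1 : Continuous (fun h : ℝ => M.step f t q h) :=
    (M.contDiff_step hf).continuous.comp (by fun_prop : Continuous fun h : ℝ => (t, q, h))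
  have h2 := h1.tendsto 0
  rw [show M.step f t q 0 = q by simp [step]] at h2
  exact h2.mono_left nhdsWithin_le_nhds

theorem exists_norm_step_le (M : ExplicitRK s)
    (hf : ContDiff ℝ ∞ (fun x : ℝ × EuclideanSpace ℝ (Fin m) => f x.1 x.2)) (T ρ : ℝ) :
    ∃ ρ₁ : ℝ, ∀ t ∈ Icc 0 T, ∀ q, ‖q‖ ≤ ρ → ∀ h ∈ Icc (0 : ℝ) 1, ‖M.step f t q h‖ ≤ ρ₁ := by
  obtain ⟨C, hC⟩ := (isCompact_Icc.prod ((isCompact_closedBall (0 : EuclideanSpace ℝ (Fin m)) ρ).prod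
    isCompact_Icc)).exists_bound_of_continuousOn (s := Icc 0 T ×ˢ Metric.closedBall 0 ρ ×ˢ Icc 0 1)
    (M.contDiff_step hf).continuous.continuousOn
  exact ⟨C, fun t ht q hq h hh => hC (t, q, h) ⟨ht, by simpa using hq, hh⟩⟩

/-- The increment is Lipschitz on a compact convex set and enters with a factor `h`; the resulting
`1 + L * h` has bounded powers over a fixed time span. -/
theorem exists_lipschitz_step (M : ExplicitRK s)
    (hf : ContDiff ℝ ∞ (fun x : ℝ × EuclideanSpace ℝ (Fin m) => f x.1 x.2)) (T ρ : ℝ) :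
    ∃ L : ℝ, 0 ≤ L ∧ ∀ t ∈ Icc 0 T, ∀ x y, ‖x‖ ≤ ρ → ‖y‖ ≤ ρ → ∀ h ∈ Icc (0 : ℝ) 1,
      ‖M.step f t x h - M.step f t y h‖ ≤ (1 + L * h) * ‖x - y‖ := by
  obtain ⟨L, hL⟩ := ContDiffOn.exists_lipschitzOnWith
    (s := Icc 0 T ×ˢ Metric.closedBall (0 : EuclideanSpace ℝ (Fin m)) ρ ×ˢ Icc (0 : ℝ) 1)
    (M.contDiff_increment hf).contDiffOn (by simp)
    ((convex_Icc _ _).prod ((convex_closedBall _ _).prod (convex_Icc _ _)))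
    (isCompact_Icc.prod ((isCompact_closedBall _ _).prod isCompact_Icc))
  refine ⟨L, L.2, fun t ht x y hx hy h hh => ?_⟩
  have h1 := hL.dist_le_mul (t, x, h) ⟨ht, by simpa using hx, hh⟩ (t, y, h)
    ⟨ht, by simpa using hy, hh⟩
  have h2 : dist (t, x, h) (t, y, h) = ‖x - y‖ := by simp [dist_eq_norm]
  rw [h2, dist_eq_norm] at h1
  have h3 : M.step f t x h - M.step f t y h = (x - y) +
      h • (∑ j, M.b j • M.stage f t x h j - ∑ j, M.b j • M.stage f t y h j) := by
    rw [step, step, smul_sub]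
    abel
  rw [h3]
  refine (norm_add_le _ _).trans ?_
  rw [norm_smul, Real.norm_of_nonneg hh.1]
  have := mul_le_mul_of_nonneg_left h1 hh.1
  linarith

/-- The defect of an invariant after one step, from a fixed value. -/
theorem invariant_defect_isBigO (M : ExplicitRK s) {p : ℕ} (hM : M.HasOrder p)
    (hf : ContDiff ℝ ∞ (fun x : ℝ × EuclideanSpace ℝ (Fin m) => f x.1 x.2))
    {G : EuclideanSpace ℝ (Fin m) → ℝ} (hG : ContDiff ℝ ∞ G) {T : ℝ}
    (hinv : ∀ t ∈ Icc 0 T, ∀ q, inner ℝ (gradient G q) (f t q) = 0)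
    {t : ℝ} (ht : t ∈ Ico 0 T) (q : EuclideanSpace ℝ (Fin m)) :
    (fun h : ℝ => G (M.step f t q h) - G q) =O[𝓝[>] 0] fun h : ℝ => h ^ (p + 1) := by
  obtain ⟨ε₀, hε₀, u, hu, rfl⟩ := exists_isSolutionOn hf t q
  -- The solution is cut off at `T`, since invariance is assumed only on `[0, T]`.
  set ε := min ε₀ (T - t)
  have hε : 0 < ε := lt_min hε₀ (sub_pos.2 ht.2)
  have hu' : IsSolutionOn f t (t + ε) u := hu.mono le_rfl (by linarith [min_le_left ε₀ (T - t)])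
  have hT : t + ε ≤ T := by linarith [min_le_right ε₀ (T - t)]
  have hstrict := (hG.contDiffAt.hasStrictFDerivAt (x := u t) (by simp)).isBigO_sub
  have hlim : Tendsto (fun h => (M.step f t (u t) h, u (t + h))) (𝓝[>] 0) (𝓝 (u t, u t)) :=
    (M.tendsto_step hf t (u t)).prodMk_nhds (hu'.tendsto_shift hε)
  refine ((hstrict.comp_tendsto hlim).trans (hM m f hf t ε u hε hu')).congr' ?_ EventuallyEq.rfl
  filter_upwards [Ioo_mem_nhdsGT hε] with h hh
  simp only [Function.comp]
  rw [hu'.invariant_eq hG (fun t' ht' => hinv t' ⟨ht.1.trans ht'.1, ht'.2.trans hT⟩) (t + h)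
    ⟨by linarith [hh.1], by linarith [hh.2]⟩]

/-- The defect of an invariant after one step, uniformly for values in a bounded set. -/
theorem exists_invariant_defect_le (M : ExplicitRK s) {p : ℕ} (hM : M.HasOrder p)
    (hf : ContDiff ℝ ∞ (fun x : ℝ × EuclideanSpace ℝ (Fin m) => f x.1 x.2))
    {G : EuclideanSpace ℝ (Fin m) → ℝ} (hG : ContDiff ℝ ∞ G) {T : ℝ}
    (hinv : ∀ t ∈ Icc 0 T, ∀ q, inner ℝ (gradient G q) (f t q) = 0) (ρ : ℝ) :
    ∃ C : ℝ, 0 ≤ C ∧ ∀ t ∈ Ico 0 T, ∀ q, ‖q‖ ≤ ρ → ∀ h ∈ Icc (0 : ℝ) 1,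
      |G (M.step f t q h) - G q| ≤ C * h ^ (p + 1) := by
  have hstep := M.contDiff_step hf
  -- The curve is `h ↦ (t, q, h)`. It involves no exact solution, so the bound holds for all `h ≤
  -- 1`, whatever the lifespan of the solution through `q`.
  obtain ⟨C, hC0, hC⟩ := exists_uniform_pow_bound
    (X := fun _ : ℝ × EuclideanSpace ℝ (Fin m) × ℝ => ((0 : ℝ), (0 : EuclideanSpace ℝ (Fin m)), (1 : ℝ)))
    (φ := fun z => G (M.step f z.1 z.2.1 z.2.2) - G z.2.1) contDiff_const
    ((hG.comp hstep).sub (hG.comp (by fun_prop))) p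
    (K := Icc 0 T ×ˢ Metric.closedBall 0 ρ ×ˢ Icc 0 1)
    (isCompact_Icc.prod ((isCompact_closedBall _ _).prod isCompact_Icc))
  refine ⟨C, hC0, fun t ht q hq h hh => ?_⟩
  exact hC 1 (fun h => (t, q, h)) one_pos
    (fun h _ => ((hasDerivAt_const h t).prodMk
      ((hasDerivAt_const h q).prodMk (hasDerivAt_id h))).hasDerivWithinAt)
    (fun h hh => ⟨⟨ht.1, ht.2.le⟩, by simpa using hq, hh⟩)
    (M.invariant_defect_isBigO hM hf hG hinv ht q) h hh

/-- The local error, uniformly along an exact solution. -/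
theorem exists_local_error_le (M : ExplicitRK s) {p : ℕ} (hM : M.HasOrder p)
    (hf : ContDiff ℝ ∞ (fun x : ℝ × EuclideanSpace ℝ (Fin m) => f x.1 x.2)) {T : ℝ}
    {u : ℝ → EuclideanSpace ℝ (Fin m)} (hu : IsSolutionOn f 0 T u) {ρ : ℝ}
    (hρ : ∀ t ∈ Icc 0 T, ‖u t‖ ≤ ρ) :
    ∃ C : ℝ, 0 ≤ C ∧ ∀ t ∈ Icc 0 T, ∀ h ∈ Ioc (0 : ℝ) 1, t + h ≤ T →
      ‖M.step f t (u t) h - u (t + h)‖ ≤ C * h ^ (p + 1) := by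
  have hstep := M.contDiff_step hf
  -- Here the exact solution is carried as an extra coordinate, next to the frozen pair `(t, u t)`
  -- and the elapsed time.
  obtain ⟨C, hC0, hC⟩ := exists_uniform_pow_bound
    (X := fun z : (ℝ × EuclideanSpace ℝ (Fin m) × ℝ) × EuclideanSpace ℝ (Fin m) =>
      (((0 : ℝ), (0 : EuclideanSpace ℝ (Fin m)), (1 : ℝ)), f (z.1.1 + z.1.2.2) z.2))
    (φ := fun z => M.step f z.1.1 z.1.2.1 z.1.2.2 - z.2)
    (contDiff_const.prodMk (hf.comp (g := fun x : ℝ × EuclideanSpace ℝ (Fin m) => f x.1 x.2)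
      (f := fun z : (ℝ × EuclideanSpace ℝ (Fin m) × ℝ) × EuclideanSpace ℝ (Fin m) =>
        (z.1.1 + z.1.2.2, z.2)) (by fun_prop)))
    ((hstep.comp contDiff_fst).sub contDiff_snd) p
    (K := (Icc 0 T ×ˢ Metric.closedBall 0 ρ ×ˢ Icc 0 1) ×ˢ Metric.closedBall 0 ρ)
    ((isCompact_Icc.prod ((isCompact_closedBall _ _).prod isCompact_Icc)).prod
      (isCompact_closedBall _ _))
  refine ⟨C, hC0, fun t ht h hh hT => ?_⟩
  have hsol : IsSolutionOn f t (t + h) u := hu.mono ht.1 hT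
  exact hC h (fun x => ((t, u t, x), u (t + x))) hh.1
    (fun x hx => ((hasDerivAt_const x t).prodMk
      ((hasDerivAt_const x (u t)).prodMk (hasDerivAt_id x))).hasDerivWithinAt.prodMk
        (hsol.hasDerivWithinAt_shift x hx))
    (fun x hx => ⟨⟨ht, by simpa using hρ t ht, hx.1, hx.2.trans hh.2⟩, by
      simpa using hρ (t + x) ⟨by linarith [ht.1, hx.1], by linarith [hx.2]⟩⟩)
    (hM m f hf t h u hh.1 hsol) h ⟨hh.1.le, le_rfl⟩

end ExplicitRK

/-! ### Lower bounds for the slope along the search directions. -/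

theorem norm_inv_norm_smul_le_one {E : Type*} [NormedAddCommGroup E] [NormedSpace ℝ E] (x : E) :
    ‖‖x‖⁻¹ • x‖ ≤ 1 := by
  rw [norm_smul, norm_inv, norm_norm]
  -- This includes `x = 0`, where the normalized vector is `0`; hence no nonvanishing assumption.
  exact inv_mul_le_one

theorem half_mul_rpow_le_abs_of_expansion {A B β K h r : ℝ} (hB : β ≤ |B|)
    (hh : h ∈ Ioc 0 (β / (2 * (|K| + 1)))) (hA : |A - B * h ^ r| ≤ K * h ^ (r + 1)) :
    β / 2 * h ^ r ≤ |A| := by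
  have hhr : 0 < h ^ r := Real.rpow_pos_of_pos hh.1 r
  have h1 : h * (2 * (|K| + 1)) ≤ β := (le_div_iff₀ (by positivity)).1 hh.2
  have h2 : |B| * h ^ r - |A| ≤ K * h ^ (r + 1) := by
    have := abs_sub_abs_le_abs_sub (B * h ^ r) A
    rw [abs_sub_comm, abs_mul, abs_of_pos hhr] at this
    exact this.trans hA
  rw [Real.rpow_add_one hh.1.ne'] at h2
  have h3 : K * h ≤ β / 2 := by
    have := mul_le_mul_of_nonneg_right (le_abs_self K) hh.1.le
    nlinarith [hh.1]
  nlinarith [mul_le_mul_of_nonneg_right hB hhr.le, mul_le_mul_of_nonneg_right h3 hhr.le]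

namespace ExplicitRK

variable {m s : ℕ} {f : ℝ → EuclideanSpace ℝ (Fin m) → EuclideanSpace ℝ (Fin m)}
  {G : EuclideanSpace ℝ (Fin m) → ℝ}

/-- The orthogonal projection is self-adjoint and idempotent, so pairing `∇G` with `∇G_s` gives
`‖∇G_s‖²`. -/
theorem abs_inner_quasiOrthogonalDir (M : ExplicitRK s) (t : ℝ) (q : EuclideanSpace ℝ (Fin m))
    (h : ℝ) :
    |inner ℝ (gradient G (M.step f t q h)) (M.quasiOrthogonalDir f G t q h)| =
      ‖M.gradS f G t q h‖ := by
  have h1 : inner ℝ (gradient G (M.step f t q h)) (M.gradS f G t q h) =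
      ‖M.gradS f G t q h‖ * ‖M.gradS f G t q h‖ := by
    rw [← real_inner_self_eq_norm_mul_norm]
    conv_rhs => rw [gradS, Submodule.inner_starProjection_left_eq_right]
    rw [gradS, Submodule.starProjection_eq_self_iff.2 (Submodule.starProjection_apply_mem _ _)]
  rw [quasiOrthogonalDir, real_inner_smul_right, h1]
  rcases eq_or_ne ‖M.gradS f G t q h‖ 0 with h0 | h0
  · simp [h0]
  · rw [inv_mul_cancel_left₀ h0, abs_norm]

/-- A vector of `𝒮` sees only the projected gradient; Cauchy–Schwarz does the rest. This transfers
transversality to the quasi-orthogonal method. -/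
theorem abs_inner_directionalDir_le (M : ExplicitRK s) (b' : Fin s → ℝ) (t : ℝ)
    (q : EuclideanSpace ℝ (Fin m)) (h : ℝ) :
    |inner ℝ (gradient G (M.step f t q h)) (M.directionalDir b' f t q h)| ≤
      ‖M.gradS f G t q h‖ := by
  have hmem : M.directionalDir b' f t q h ∈ M.stageSpan f t q h :=
    Submodule.smul_mem _ _ (Submodule.sum_mem _ fun j _ =>
      Submodule.smul_mem _ _ (Submodule.subset_span ⟨j, rfl⟩))
  rw [← Submodule.starProjection_eq_self_iff.2 hmem,
    ← Submodule.inner_starProjection_left_eq_right]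
  refine (abs_real_inner_le_norm _ _).trans ?_
  exact mul_le_of_le_one_right (norm_nonneg _) (norm_inv_norm_smul_le_one _)

/-! ### Projected steps: local order and convergence for any transversal direction. -/

theorem locallySolvableWithOrder_of_transversal (M : ExplicitRK s) {p : ℕ} (hM : M.HasOrder p)
    (hf : ContDiff ℝ ∞ (fun x : ℝ × EuclideanSpace ℝ (Fin m) => f x.1 x.2))
    (hG : ContDiff ℝ ∞ G) {T : ℝ}
    (hinv : ∀ t ∈ Icc 0 T, ∀ q, inner ℝ (gradient G q) (f t q) = 0)
    {r : ℝ} (hr0 : 0 ≤ r) (hr : r ≤ p / 2)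
    {Φ : ℝ → EuclideanSpace ℝ (Fin m) → ℝ → EuclideanSpace ℝ (Fin m)}
    (hΦ : ∀ t q h, ‖Φ t q h‖ ≤ 1) {t : ℝ} (ht : t ∈ Ico 0 T) (q : EuclideanSpace ℝ (Fin m))
    {c : ℝ} (hc : 0 < c)
    (htr : ∀ᶠ h in 𝓝[>] (0 : ℝ),
      c * h ^ r ≤ |inner ℝ (gradient G (M.step f t q h)) (Φ t q h)|) :
    M.LocallySolvableWithOrder f G Φ t q r (p - r) := by
  obtain ⟨C, hC0, hC⟩ := M.exists_invariant_defect_le hM hf hG hinv ‖q‖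
  obtain ⟨ρ, hρ⟩ := M.exists_norm_step_le hf T ‖q‖
  obtain ⟨δ, hδ, h₀, hh₀, hh1, C', hC', hwin⟩ := exists_projection_window hG ρ hC0 hc hr0 hr
  have hev : ∀ᶠ h in 𝓝[>] (0 : ℝ), h ∈ Ioc 0 h₀ ∧
      (∃! l : ℝ, M.IsProjParam f G Φ t q h (δ * h ^ r) l) ∧
      ∀ l : ℝ, M.IsProjParam f G Φ t q h (δ * h ^ r) l → |l| ≤ C' * h ^ (p - r + 1) := by
    filter_upwards [htr, Ioc_mem_nhdsGT hh₀] with h hA hh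
    have hI : h ∈ Icc (0 : ℝ) 1 := ⟨hh.1.le, hh.2.trans hh1⟩
    have := hwin h hh (M.step f t q h) (Φ t q h) (G q) (hρ t ⟨ht.1, ht.2.le⟩ q le_rfl h hI)
      (hΦ t q h) (hC t ht q le_rfl h hI) hA
    exact ⟨hh, this.1, fun l hl => this.2 l hl.1 hl.2⟩
  refine ⟨δ, hδ, hev.mono fun h hh => hh.2.1, fun ε u hε hu huq => ?_⟩
  subst huq
  obtain ⟨D, hD0, hD⟩ := (hM m f hf t ε u hε hu).exists_nonneg
  refine ⟨D + C', ?_⟩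
  filter_upwards [hev, hD.bound] with h hh hb l hl
  have hpos : 0 < h := hh.1.1
  have h1 : h ^ (p + 1) ≤ h ^ ((p : ℝ) - r + 1) := by
    rw [← Real.rpow_natCast]
    refine Real.rpow_le_rpow_of_exponent_ge hpos (hh.1.2.trans hh1) ?_
    push_cast
    linarith
  rw [Real.norm_of_nonneg (by positivity)] at hb
  have h2 := hh.2.2 l hl
  calc ‖M.step f t (u t) h + l • Φ t (u t) h - u (t + h)‖
      = ‖(M.step f t (u t) h - u (t + h)) + l • Φ t (u t) h‖ := by congr 1; abel
    _ ≤ ‖M.step f t (u t) h - u (t + h)‖ + |l| * 1 := by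
        refine (norm_add_le _ _).trans (add_le_add_right ?_ _)
        rw [norm_smul]
        exact mul_le_mul_of_nonneg_left (hΦ _ _ _) (abs_nonneg l)
    _ ≤ D * h ^ ((p : ℝ) - r + 1) + C' * h ^ ((p : ℝ) - r + 1) := by
        rw [mul_one]
        exact add_le_add (hb.trans (mul_le_mul_of_nonneg_left h1 hD0)) h2
    _ = (D + C') * h ^ ((p : ℝ) - r + 1) := by ring

/-- One projected step near an exact solution: unique solvability, and the error recursion. -/
theorem exists_projected_step_error (M : ExplicitRK s) {p : ℕ} (hM : M.HasOrder p)
    (hf : ContDiff ℝ ∞ (fun x : ℝ × EuclideanSpace ℝ (Fin m) => f x.1 x.2))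
    (hG : ContDiff ℝ ∞ G) {T : ℝ}
    (hinv : ∀ t ∈ Icc 0 T, ∀ q, inner ℝ (gradient G q) (f t q) = 0)
    {r : ℝ} (hr0 : 0 ≤ r) (hr : r ≤ p / 2)
    {Φ : ℝ → EuclideanSpace ℝ (Fin m) → ℝ → EuclideanSpace ℝ (Fin m)}
    (hΦ : ∀ t q h, ‖Φ t q h‖ ≤ 1) {u : ℝ → EuclideanSpace ℝ (Fin m)} (hu : IsSolutionOn f 0 T u)
    {ρ c h₁ : ℝ} (hρ : 0 < ρ) (hc : 0 < c) (hh₁ : 0 < h₁)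
    (htr : ∀ t ∈ Icc 0 T, ∀ q, ‖q - u t‖ ≤ ρ → ∀ h ∈ Ioc 0 h₁, t + h ≤ T →
      c * h ^ r ≤ |inner ℝ (gradient G (M.step f t q h)) (Φ t q h)|) :
    ∃ δ > 0, ∃ h₀ > 0, h₀ ≤ 1 ∧ ∃ L D : ℝ, 0 ≤ L ∧ 0 ≤ D ∧
      ∀ t ∈ Icc 0 T, ∀ q, ‖q - u t‖ ≤ ρ → ∀ h ∈ Ioc 0 h₀, t + h ≤ T →
        (∃! l : ℝ, M.IsProjParam f G Φ t q h (δ * h ^ r) l) ∧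
        ∀ l : ℝ, M.IsProjParam f G Φ t q h (δ * h ^ r) l →
          ‖M.step f t q h + l • Φ t q h - u (t + h)‖ ≤
            (1 + L * h) * ‖q - u t‖ + D * h * h ^ (p - r) := by
  obtain ⟨ρ₀, hρ₀⟩ := isCompact_Icc.exists_bound_of_continuousOn hu.continuousOn
  have hball : ∀ t ∈ Icc 0 T, ∀ q, ‖q - u t‖ ≤ ρ → ‖q‖ ≤ ρ₀ + ρ := fun t ht q hq => by
    have := norm_add_le (q - u t) (u t)
    rw [sub_add_cancel] at this
    linarith [hρ₀ t ht]
  obtain ⟨C, hC0, hC⟩ := M.exists_invariant_defect_le hM hf hG hinv (ρ₀ + ρ)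
  obtain ⟨ρ₁, hρ₁⟩ := M.exists_norm_step_le hf T (ρ₀ + ρ)
  obtain ⟨L, hL0, hL⟩ := M.exists_lipschitz_step hf T (ρ₀ + ρ)
  obtain ⟨D, hD0, hD⟩ := M.exists_local_error_le hM hf hu hρ₀
  obtain ⟨δ, hδ, h₀, hh₀, hh1, C', hC', hwin⟩ := exists_projection_window hG ρ₁ hC0 hc hr0 hr
  refine ⟨δ, hδ, min h₀ h₁, lt_min hh₀ hh₁, (min_le_left _ _).trans hh1, L, D + C', hL0,
    add_nonneg hD0 hC', fun t ht q hq h hh hT => ?_⟩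
  have hpos : 0 < h := hh.1
  have hle : h ≤ 1 := hh.2.trans ((min_le_left _ _).trans hh1)
  have hI : h ∈ Icc (0 : ℝ) 1 := ⟨hpos.le, hle⟩
  have hw := hwin h ⟨hpos, hh.2.trans (min_le_left _ _)⟩ (M.step f t q h) (Φ t q h) (G q)
    (hρ₁ t ht q (hball t ht q hq) h hI) (hΦ t q h)
    (hC t ⟨ht.1, by linarith⟩ q (hball t ht q hq) h hI)
    (htr t ht q hq h ⟨hpos, hh.2.trans (min_le_right _ _)⟩ hT)
  refine ⟨hw.1, fun l hl => ?_⟩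
  have hut : ‖u t‖ ≤ ρ₀ + ρ := hball t ht _ (by simpa using hρ.le)
  have e1 := hL t ht q (u t) (hball t ht q hq) hut h hI
  have e2 := hD t ht h ⟨hpos, hle⟩ hT
  have e3 := hw.2 l hl.1 hl.2
  have hp1 : h ^ ((p : ℝ) - r + 1) = h * h ^ ((p : ℝ) - r) := by
    rw [Real.rpow_add_one hpos.ne', mul_comm]
  have h1 : h ^ (p + 1) ≤ h ^ ((p : ℝ) - r + 1) := by
    rw [← Real.rpow_natCast]
    refine Real.rpow_le_rpow_of_exponent_ge hpos hle ?_
    push_cast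
    linarith
  have e2' := e2.trans (mul_le_mul_of_nonneg_left h1 hD0)
  have e4 : ‖l • Φ t q h‖ ≤ |l| := by
    rw [norm_smul]
    exact mul_le_of_le_one_right (norm_nonneg l) (hΦ t q h)
  -- Propagated error, local error on the exact solution, and projection.
  have e5 : M.step f t q h + l • Φ t q h - u (t + h) = (M.step f t q h - M.step f t (u t) h) +
      (M.step f t (u t) h - u (t + h)) + l • Φ t q h := by abel
  rw [e5]
  refine norm_add₃_le.trans ?_
  rw [hp1] at e2' e3
  linarith

/-- Bootstrap: transversality is known only in a tube of radius `ρ` around `u`, and the Gronwall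
bound, being smaller than `ρ` for small `h`, keeps the run inside. -/
theorem globallySolvableWithOrder_of_transversal (M : ExplicitRK s) {p : ℕ} (hp : 2 ≤ p)
    (hM : M.HasOrder p)
    (hf : ContDiff ℝ ∞ (fun x : ℝ × EuclideanSpace ℝ (Fin m) => f x.1 x.2))
    (hG : ContDiff ℝ ∞ G) {T : ℝ}
    (hinv : ∀ t ∈ Icc 0 T, ∀ q, inner ℝ (gradient G q) (f t q) = 0)
    {r : ℝ} (hr0 : 0 ≤ r) (hr : r ≤ p / 2)
    {Φ : ℝ → EuclideanSpace ℝ (Fin m) → ℝ → EuclideanSpace ℝ (Fin m)}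
    (hΦ : ∀ t q h, ‖Φ t q h‖ ≤ 1) {u : ℝ → EuclideanSpace ℝ (Fin m)} (hu : IsSolutionOn f 0 T u)
    {ρ c h₁ : ℝ} (hρ : 0 < ρ) (hc : 0 < c) (hh₁ : 0 < h₁)
    (htr : ∀ t ∈ Icc 0 T, ∀ q, ‖q - u t‖ ≤ ρ → ∀ h ∈ Ioc 0 h₁, t + h ≤ T →
      c * h ^ r ≤ |inner ℝ (gradient G (M.step f t q h)) (Φ t q h)|) :
    M.GloballySolvableWithOrder f G Φ T u r (p - r) := by
  obtain ⟨δ, hδ, h₀, hh₀, hh1, L, D, hL0, hD0, hstep⟩ :=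
    M.exists_projected_step_error hM hf hG hinv hr0 hr hΦ hu hρ hc hh₁ htr
  set E := |T| * D * Real.exp (L * |T|) with hE
  have hE0 : 0 ≤ E := by positivity
  -- This bound on `h` gives `E * h ≤ ρ`, hence `E * h ^ (p - r) ≤ ρ` because `p - r ≥ p / 2 ≥ 1`;
  -- the latter is where `2 ≤ p` is needed.
  refine ⟨δ, hδ, min h₀ (ρ / (E + 1)), by positivity, E, fun h hh N hN => ?_⟩
  have hpos : 0 < h := hh.1
  have hhI : h ∈ Ioc 0 h₀ := ⟨hpos, hh.2.trans (min_le_left _ _)⟩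
  have hκ : h ^ ((p : ℝ) - r) ≤ h := by
    have hp' : (2 : ℝ) ≤ p := by exact_mod_cast hp
    calc h ^ ((p : ℝ) - r) ≤ h ^ (1 : ℝ) :=
          Real.rpow_le_rpow_of_exponent_ge hpos (hhI.2.trans hh1) (by linarith)
      _ = h := Real.rpow_one h
  have hκ0 : 0 < h ^ ((p : ℝ) - r) := Real.rpow_pos_of_pos hpos _
  have hEρ : E * h ^ ((p : ℝ) - r) ≤ ρ := by
    have h2 : h * (E + 1) ≤ ρ := (le_div_iff₀ (by positivity)).1 (hh.2.trans (min_le_right _ _))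
    nlinarith
  have htime : ∀ n ≤ N, (n : ℝ) * h ∈ Icc 0 T := fun n hn =>
    ⟨by positivity, (mul_le_mul_of_nonneg_right (by exact_mod_cast hn) hpos.le).trans hN⟩
  have hstep' : ∀ n < N, ∀ q, ‖q - u (n * h)‖ ≤ ρ →
      (∃! l : ℝ, M.IsProjParam f G Φ (n * h) q h (δ * h ^ r) l) ∧
        ∀ l : ℝ, M.IsProjParam f G Φ (n * h) q h (δ * h ^ r) l →
          ‖M.step f (n * h) q h + l • Φ (n * h) q h - u ((n + 1 : ℕ) * h)‖ ≤
            (1 + L * h) * ‖q - u (n * h)‖ + D * h * h ^ ((p : ℝ) - r) := by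
    intro n hn q hq
    have h3 : ((n + 1 : ℕ) : ℝ) * h = n * h + h := by push_cast; ring
    rw [h3]
    exact hstep (n * h) (htime n hn.le) q hq h hhI (h3 ▸ (htime (n + 1) hn).2)
  have hgrow : ∀ n ≤ N, n * h * D * Real.exp (L * (n * h)) ≤ E := by
    intro n hn
    have h4 : (n : ℝ) * h ≤ |T| := (htime n hn).2.trans (le_abs_self T)
    rw [hE]
    gcongr
  -- Stated for runs of every length `k ≤ N`, since the existence proof extends partial runs one
  -- step at a time.
  have herr : ∀ k ≤ N, ∀ y, M.IsProjectedRun f G Φ (u 0) h (δ * h ^ r) k y → ∀ n ≤ k,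
      ‖y n - u (n * h)‖ ≤ n * h * D * Real.exp (L * (n * h)) * h ^ ((p : ℝ) - r) := by
    intro k hk y hy n
    induction n with
    | zero => simp [hy.1]
    | succ n ih =>
      intro hn
      have h5 := ih (by omega)
      have h6 : ‖y n - u (n * h)‖ ≤ ρ :=
        h5.trans ((mul_le_mul_of_nonneg_right (hgrow n (by omega)) hκ0.le).trans hEρ)
      obtain ⟨l, hl, hy1⟩ := hy.2 n (by omega)
      have h7 := (hstep' n (by omega) (y n) h6).2 l hl
      rw [hy1]
      refine h7.trans ?_
      set e := Real.exp (L * (n * h)) with he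
      have he1 : Real.exp (L * ((n + 1 : ℕ) * h)) = e * Real.exp (L * h) := by
        rw [he, ← Real.exp_add]
        push_cast
        ring_nf
      have he2 : 1 + L * h ≤ Real.exp (L * h) := by linarith [Real.add_one_le_exp (L * h)]
      have he3 : 1 ≤ e * Real.exp (L * h) := by
        rw [← he1]
        exact Real.one_le_exp (by positivity)
      rw [he1]
      calc (1 + L * h) * ‖y n - u (n * h)‖ + D * h * h ^ ((p : ℝ) - r)
          ≤ Real.exp (L * h) * (n * h * D * e * h ^ ((p : ℝ) - r)) +
              D * h * h ^ ((p : ℝ) - r) * (e * Real.exp (L * h)) := by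
            refine add_le_add ?_ (le_mul_of_one_le_right (by positivity) he3)
            exact mul_le_mul he2 h5 (norm_nonneg _) (Real.exp_pos _).le
        _ = ((n + 1 : ℕ) : ℝ) * h * D * (e * Real.exp (L * h)) * h ^ ((p : ℝ) - r) := by
            push_cast
            ring
  have herr' : ∀ k ≤ N, ∀ y, M.IsProjectedRun f G Φ (u 0) h (δ * h ^ r) k y → ∀ n ≤ k,
      ‖y n - u (n * h)‖ ≤ E * h ^ ((p : ℝ) - r) := fun k hk y hy n hn =>
    (herr k hk y hy n hn).trans
      (mul_le_mul_of_nonneg_right (hgrow n (hn.trans hk)) hκ0.le)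
  refine ⟨?_, fun y hy => ⟨fun n hn => ?_, herr' N le_rfl y hy⟩⟩
  · have hrun : ∀ k ≤ N, ∃ y, M.IsProjectedRun f G Φ (u 0) h (δ * h ^ r) k y := by
      intro k
      induction k with
      | zero => exact fun _ => ⟨fun _ => u 0, rfl, fun n hn => absurd hn (Nat.not_lt_zero n)⟩
      | succ k ih =>
        intro hk
        obtain ⟨y, hy⟩ := ih (by omega)
        obtain ⟨l, hl, -⟩ := (hstep' k (by omega) (y k)
          ((herr' k (by omega) y hy k le_rfl).trans hEρ)).1
        refine ⟨Function.update y (k + 1) (M.step f (k * h) (y k) h + l • Φ (k * h) (y k) h),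
          ?_, fun n hn => ?_⟩
        · rw [Function.update_of_ne (by omega)]
          exact hy.1
        · rw [Function.update_of_ne (by omega : n ≠ k + 1)]
          rcases Nat.lt_succ_iff_lt_or_eq.1 hn with hn' | rfl
          · rw [Function.update_of_ne (by omega)]
            exact hy.2 n hn'
          · rw [Function.update_self]
            exact ⟨l, hl, rfl⟩
    exact hrun N le_rfl
  · exact (hstep' n hn (y n) ((herr' N le_rfl y hy n hn.le).trans hEρ)).1

end ExplicitRK

/-! ### Both methods, on one step and on the whole interval. -/

theorem mainTheorem3 {m s : ℕ} (M : ExplicitRK s) (b' : Fin s → ℝ) (p : ℕ) (hp : 2 ≤ p)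
    (hM : M.HasOrder p)
    (R : ℝ → EuclideanSpace ℝ (Fin m) → EuclideanSpace ℝ (Fin m))
    (hR : ContDiff ℝ ∞ (fun x : ℝ × EuclideanSpace ℝ (Fin m) => R x.1 x.2))
    (G : EuclideanSpace ℝ (Fin m) → ℝ) (hG : ContDiff ℝ ∞ G) (T : ℝ)
    (hinv : ∀ t ∈ Icc 0 T, ∀ q, inner ℝ (gradient G q) (R t q) = 0)
    (r : ℝ) (hr0 : 0 ≤ r) (hr : r ≤ p / 2) :
    -- one step from a fixed value `q` at a fixed time `t`
    (∀ t ∈ Ico 0 T, ∀ (q : EuclideanSpace ℝ (Fin m)) (B : ℝ), B ≠ 0 →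
      ((fun h : ℝ => inner ℝ (gradient G (M.step R t q h)) (M.directionalDir b' R t q h)
          - B * h ^ r) =O[𝓝[>] 0] fun h : ℝ => h ^ (r + 1)) →
      (∀ᶠ h in 𝓝[>] (0 : ℝ), M.gradS R G t q h ≠ 0) ∧
      M.LocallySolvableWithOrder R G (M.directionalDir b' R) t q r (p - r) ∧
      M.LocallySolvableWithOrder R G (M.quasiOrthogonalDir R G) t q r (p - r)) ∧
    -- the whole computation on `[0, T]`
    (∀ u : ℝ → EuclideanSpace ℝ (Fin m), IsSolutionOn R 0 T u →
      ∀ (B : ℝ → EuclideanSpace ℝ (Fin m) → ℝ) (ρ β h₁ K : ℝ), 0 < ρ → 0 < β → 0 < h₁ →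
      (∀ t ∈ Icc 0 T, ∀ q, ‖q - u t‖ ≤ ρ → β ≤ |B t q| ∧ ∀ h ∈ Ioc 0 h₁, t + h ≤ T →
        |inner ℝ (gradient G (M.step R t q h)) (M.directionalDir b' R t q h)
          - B t q * h ^ r| ≤ K * h ^ (r + 1)) →
      (∃ ρ' > 0, ∃ h₀ > 0, ∀ t ∈ Icc 0 T, ∀ q, ‖q - u t‖ ≤ ρ' → ∀ h ∈ Ioc 0 h₀, t + h ≤ T →
        M.gradS R G t q h ≠ 0) ∧
      M.GloballySolvableWithOrder R G (M.directionalDir b' R) T u r (p - r) ∧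
      M.GloballySolvableWithOrder R G (M.quasiOrthogonalDir R G) T u r (p - r)) := by
  refine ⟨fun t ht q B hB hexp => ?_, fun u hu B ρ β h₁ K hρ hβ hh₁ hexp => ?_⟩
  · obtain ⟨K, hK⟩ := hexp.bound
    have hB' : 0 < |B| := abs_pos.2 hB
    have htr : ∀ᶠ h in 𝓝[>] (0 : ℝ), 0 < |B| / 2 * h ^ r ∧ |B| / 2 * h ^ r ≤
        |inner ℝ (gradient G (M.step R t q h)) (M.directionalDir b' R t q h)| := by
      filter_upwards [hK, Ioc_mem_nhdsGT (show 0 < |B| / (2 * (|K| + 1)) by positivity)]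
        with h hb hh
      have hpos : 0 < h := hh.1
      rw [Real.norm_eq_abs, Real.norm_of_nonneg (by positivity)] at hb
      exact ⟨by positivity, half_mul_rpow_le_abs_of_expansion le_rfl hh hb⟩
    refine ⟨htr.mono fun h hh => ?_, ?_, ?_⟩
    · exact norm_pos_iff.1 (hh.1.trans_le (hh.2.trans (M.abs_inner_directionalDir_le b' t q h)))
    · exact M.locallySolvableWithOrder_of_transversal hM hR hG hinv hr0 hr
        (fun _ _ _ => norm_inv_norm_smul_le_one _) ht q (half_pos hB') (htr.mono fun h hh => hh.2)
    · refine M.locallySolvableWithOrder_of_transversal hM hR hG hinv hr0 hr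
        (fun _ _ _ => norm_inv_norm_smul_le_one _) ht q (half_pos hB') (htr.mono fun h hh => ?_)
      exact (hh.2.trans (M.abs_inner_directionalDir_le b' t q h)).trans_eq
        (M.abs_inner_quasiOrthogonalDir t q h).symm
  -- Below `h₂` the remainder in the expansion takes at most half of `β * h ^ r`, so both directions
  -- are transversal at rate `β / 2` in the whole tube.
  · set h₂ := min h₁ (β / (2 * (|K| + 1)))
    have hh₂ : 0 < h₂ := by positivity
    have htr : ∀ t ∈ Icc 0 T, ∀ q, ‖q - u t‖ ≤ ρ → ∀ h ∈ Ioc 0 h₂, t + h ≤ T →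
        β / 2 * h ^ r ≤
          |inner ℝ (gradient G (M.step R t q h)) (M.directionalDir b' R t q h)| :=
      fun t ht q hq h hh hT => half_mul_rpow_le_abs_of_expansion (hexp t ht q hq).1
        ⟨hh.1, hh.2.trans (min_le_right _ _)⟩
        ((hexp t ht q hq).2 h ⟨hh.1, hh.2.trans (min_le_left _ _)⟩ hT)
    have htr' : ∀ t ∈ Icc 0 T, ∀ q, ‖q - u t‖ ≤ ρ → ∀ h ∈ Ioc 0 h₂, t + h ≤ T →
        β / 2 * h ^ r ≤ ‖M.gradS R G t q h‖ := fun t ht q hq h hh hT =>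
      (htr t ht q hq h hh hT).trans (M.abs_inner_directionalDir_le b' t q h)
    refine ⟨⟨ρ, hρ, h₂, hh₂, fun t ht q hq h hh hT => norm_pos_iff.1
      ((mul_pos (half_pos hβ) (Real.rpow_pos_of_pos hh.1 r)).trans_le
        (htr' t ht q hq h hh hT))⟩, ?_, ?_⟩
    · exact M.globallySolvableWithOrder_of_transversal hp hM hR hG hinv hr0 hr
        (fun _ _ _ => norm_inv_norm_smul_le_one _) hu hρ (half_pos hβ) hh₂ htr
    · refine M.globallySolvableWithOrder_of_transversal hp hM hR hG hinv hr0 hr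
        (fun _ _ _ => norm_inv_norm_smul_le_one _) hu hρ (half_pos hβ) hh₂
        fun t ht q hq h hh hT => ?_
      exact (htr' t ht q hq h hh hT).trans_eq (M.abs_inner_quasiOrthogonalDir t q h).symm
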